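/- A function $f:\mathbb R\to\mathbb R$ belongs to $\mathrm{SP}_2$ if $f,f',f''$ exist and are strictly positive on $\mathbb R$. Fix a horizon $T>0$ and a final potential $\phi_T\in \mathrm{SP}_2$. For $k=0,1,2,\dots$ put $s_k=\sqrt{T}\,2^{-k}$ and $t^k_i=i\,s_k^2$ for $0\le i\le 2^{2k}$. The lower potential $\phi^{\uparrow}_k$ of the adversary strategy $Q_{D(k)}$ (which plays $\pm s_k$ with probability $\tfrac12$ each) and the upper potential $\phi^{\downarrow}_k$ of the learner strategy $P_{D(k)}$ in the $k$-th discrete game are defined on the grid times by $\phi^{\uparrow}_k(T,R)=\phi^{\downarrow}_k(T,R)=\phi_T(R)$ and, for $i=2^{2k},\dots,1$, $$\phi^{\uparrow}_k(t^k_{i-1},R)=\tfrac12\big[\phi^{\uparrow}_k(t^k_i,R+s_k)+\phi^{\uparrow}_k(t^k_i,R-s_k)\big],$$ $$\phi^{\downarrow}_k(t^k_{i-1},R)=\tfrac12\big[\phi^{\downarrow}_k(t^k_i,R+s_k(1+s_k))+\phi^{\downarrow}_k(t^k_i,R-s_k(1+s_k))\big],$$ and between consecutive grid times by linear interpolation in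 time. Then for every $0<t\le T$ and every $R_0\in\mathbb R$, $$\lim_{k\to\infty}\phi^{\downarrow}_k(t,R_0)=\lim_{k\to\infty}\phi^{\uparrow}_k(t,R_0)=\mathbb E_{R\sim\mathcal N(R_0,\,T-t)}[\phi_T(R)],$$ where the expectation is an element of $(0,\infty]$ (if it is infinite, both sequences tend to $+\infty$), and $\mathcal N(R_0,0)$ is the point mass at $R_0$. The same limits hold for $\phi^{\downarrow}_k(\tau_k,R_0)$ and $\phi^{\uparrow}_k(\tau_k,R_0)$ whenever each $\tau_k$ is a grid time of the $k$-th game with $|\tau_k-t|\le s_k^2$. -/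

import Mathlib

open MeasureTheory ProbabilityTheory Filter Topology

noncomputable section

/-- Strict positivity of degree `k`: the derivatives of orders `0, …, k` of `f : ℝ → ℝ` exist
and are strictly positive everywhere. -/
def StrictlyPositive (k : ℕ) (f : ℝ → ℝ) : Prop :=
  (∀ j < k, Differentiable ℝ (iteratedDeriv j f)) ∧ ∀ j ≤ k, ∀ x, 0 < iteratedDeriv j f x

/-- The step size `s_k = √T 2^{-k}` of the `k`-discrete game on `[0, T]`. -/
def stepSize (T : ℝ) (k : ℕ) : ℝ := √T / 2 ^ k

/-- The backward recursion `V_{n+1}(R) = (V_n(R + h) + V_n(R - h)) / 2` started at `V_0 = φ`;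
the index `n` counts the steps that remain until the end of the game. -/
def backwardPotential (h : ℝ) (φ : ℝ → ℝ) : ℕ → ℝ → ℝ
  | 0, R => φ R
  | n + 1, R => (backwardPotential h φ n (R + h) + backwardPotential h φ n (R - h)) / 2

/-- Lower potential of the adversary strategy `Q_{D(k)}` (play `±s_k` with probability `1/2`)
at the grid time `t_i = i s_k²`, `0 ≤ i ≤ 2^{2k}`. -/
def lowerGridPotential (T : ℝ) (φ : ℝ → ℝ) (k i : ℕ) (R : ℝ) : ℝ :=
  backwardPotential (stepSize T k) φ (2 ^ (2 * k) - i) R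

/-- Upper potential of the learner strategy `P_{D(k)}` at the grid time `t_i = i s_k²`,
`0 ≤ i ≤ 2^{2k}`; the shift of its recursion is `s_k (1 + s_k)`. -/
def upperGridPotential (T : ℝ) (φ : ℝ → ℝ) (k i : ℕ) (R : ℝ) : ℝ :=
  backwardPotential (stepSize T k * (1 + stepSize T k)) φ (2 ^ (2 * k) - i) R

/-- Piecewise linear interpolation at time `t` of values `V i` given at the times `i δ`. -/
def timeInterpolation (δ : ℝ) (V : ℕ → ℝ) (t : ℝ) : ℝ :=
  (1 - Int.fract (t / δ)) * V ⌊t / δ⌋₊ + Int.fract (t / δ) * V (⌊t / δ⌋₊ + 1)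

/-- Lower potential of `Q_{D(k)}` at every time `t ∈ [0, T]`: the grid potential at the grid
times, linear in time between consecutive grid times. -/
def lowerPotential (T : ℝ) (φ : ℝ → ℝ) (k : ℕ) (t R : ℝ) : ℝ :=
  timeInterpolation (stepSize T k ^ 2) (fun i => lowerGridPotential T φ k i R) t

/-- Upper potential of `P_{D(k)}` at every time `t ∈ [0, T]`: the grid potential at the grid
times, linear in time between consecutive grid times. -/
def upperPotential (T : ℝ) (φ : ℝ → ℝ) (k : ℕ) (t R : ℝ) : ℝ :=
  timeInterpolation (stepSize T k ^ 2) (fun i => upperGridPotential T φ k i R) t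

/-- `u k` converges to the expectation, in `(0, ∞]`, of the positive continuous function `f`
under `γ`: to the integral if it is finite, and to `+∞` otherwise. -/
def TendstoExpectation (u : ℕ → ℝ) (f : ℝ → ℝ) (γ : Measure ℝ) : Prop :=
  (Integrable f γ → Tendsto u atTop (𝓝 (∫ x, f x ∂γ))) ∧
    (¬ Integrable f γ → Tendsto u atTop atTop)

end

/-! With `n` steps left, both potentials are expectations of `φ` at `R` plus `h` times a simple
random walk, where `h` is `s` or `s (1 + s)`. The variance `n h ^ 2` tends to `v = T - t`, so this
is a central limit theorem. Weak convergence is not enough, since `φ` may grow so fast that its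
Gaussian mean is infinite or only just finite.

For `v > 0` and an even number of steps, the average is written as a Lebesgue integral of a step
density times `φ` at the left end of the cell. The integrand converges pointwise by a local limit
theorem (`tendsto_walkWeight`). Fatou's lemma settles an infinite mean. For a finite mean, dominated
convergence needs the walk density bounded by a constant times the Gaussian density of exactly the
limiting variance (`exists_walkWeight_le`). The larger step `s (1 + s)` threatens this bound, and
the quartic term in the binomial tail exponent restores it. Monotonicity of `φ` bounds the other
factor.

Convexity of `φ` makes the potential increase with the number of steps, so odd numbers of steps are
squeezed between even ones. Interpolated values are convex combinations of grid values. -/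

/-! ### Binomial form of the backward recursion -/

/-- Closed form of the backward recursion as a binomial average. -/
theorem backwardPotential_eq_sum_antidiagonal (h : ℝ) (φ : ℝ → ℝ) (n : ℕ) (R : ℝ) :
    backwardPotential h φ n R =
      (∑ p ∈ Finset.HasAntidiagonal.antidiagonal n, (n.choose p.1 : ℝ) * φ (R + ((p.1 : ℝ) - p.2) * h)) / 2 ^ n := by
  induction n generalizing R with
  | zero => simp [backwardPotential]
  | succ n ih =>
    rw [backwardPotential, ih, ih,
      Finset.sum_antidiagonal_choose_succ_mul (fun i j => φ (R + ((i : ℝ) - j) * h))]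
    rw [Finset.sum_congr rfl (g := fun p : ℕ × ℕ =>
      (n.choose p.2 : ℝ) * φ (R + h + ((p.1 : ℝ) - p.2) * h)),
      add_comm (∑ p ∈ Finset.HasAntidiagonal.antidiagonal n, (n.choose p.1 : ℝ) * φ (R + ((p.1 : ℝ) - (p.2 + 1 : ℕ)) * h)),
      pow_succ, ← div_div, add_div (∑ p ∈ Finset.HasAntidiagonal.antidiagonal n, _)]
    · congr 3
      · refine Finset.sum_congr rfl fun p _ => ?_
        congr 2; push_cast; ring
      · refine Finset.sum_congr rfl fun p _ => ?_
        congr 2; push_cast; ring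
    · intro p hp
      rw [← Finset.HasAntidiagonal.mem_antidiagonal.1 hp, Nat.choose_symm_add]

/-- After `2 m` steps, `i` of them upward, the displacement is `2 (i - m) h`. Indexing by `l = i -
m` and using the symmetry of binomial coefficients leaves only estimates at distance `|l|` from the
centre. -/
theorem backwardPotential_even (h : ℝ) (φ : ℝ → ℝ) (m : ℕ) (R : ℝ) :
    backwardPotential h φ (2 * m) R = ∑ l ∈ Finset.Icc (-(m : ℤ)) m,
      ((2 * m).choose (m + l.natAbs) : ℝ) / 4 ^ m * φ (R + l * (2 * h)) := by
  rw [backwardPotential_eq_sum_antidiagonal, Finset.sum_div]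
  refine Finset.sum_bij (fun p _ => (p.1 : ℤ) - m) ?_ ?_ ?_ ?_
  · intro p hp
    have := Finset.HasAntidiagonal.mem_antidiagonal.1 hp
    simp only [Finset.mem_Icc]; omega
  · intro p hp q hq hpq
    have := Finset.HasAntidiagonal.mem_antidiagonal.1 hp
    have := Finset.HasAntidiagonal.mem_antidiagonal.1 hq
    ext <;> omega
  · intro l hl
    have := Finset.mem_Icc.1 hl
    refine ⟨((l + m).toNat, (m - l).toNat), ?_, ?_⟩
    · rw [Finset.HasAntidiagonal.mem_antidiagonal]; dsimp only; omega
    · dsimp only; omega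
  · rintro ⟨i, j⟩ hp
    have hij : i + j = 2 * m := Finset.HasAntidiagonal.mem_antidiagonal.1 hp
    have hc : (2 * m).choose (m + ((i : ℤ) - m).natAbs) = (2 * m).choose i := by
      rcases le_total m i with h | h
      · congr 1; omega
      · rw [← Nat.choose_symm (show i ≤ 2 * m by omega)]
        congr 1; omega
    have hr : (i : ℝ) + j = 2 * m := by exact_mod_cast hij
    dsimp only
    rw [hc, pow_mul, show (2 : ℝ) ^ 2 = 4 by norm_num, mul_div_right_comm]
    congr 3
    push_cast
    linear_combination (-h) * hr

/-! ### Sharp estimates for binomial coefficients near and far from the centre -/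

/-- The series `log ((1 + u) / (1 - u)) = 2 (u + u³/3 + ...)` has nonnegative terms; two of them are
kept. The cubic one produces the quartic gain in `choose_add_le_exp`. -/
theorem one_sub_le_one_add_mul_exp {u : ℝ} (h0 : 0 ≤ u) (h1 : u ≤ 1) :
    1 - u ≤ (1 + u) * Real.exp (-(2 * u + 2 / 3 * u ^ 3)) := by
  rcases h1.eq_or_lt with rfl | h1
  · simp; positivity
  have hs := Real.hasSum_log_sub_log_of_abs_lt_one (x := u) (by rwa [abs_of_nonneg h0])
  have := sum_le_hasSum (Finset.range 2) (fun i _ => by positivity) hs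
  simp only [Finset.sum_range_succ, Finset.sum_range_zero] at this
  norm_num at this
  rw [← Real.log_le_log_iff (by linarith) (by positivity),
    Real.log_mul (by positivity) (by positivity), Real.log_exp]
  linarith

/-- Consecutive coefficients have ratio `(m - j) / (m + j + 1) ≤ (1 - u) / (1 + u)` with `u = j /
m`. Summing `2 u + 2 u³ / 3` over `j < a` gives the exponent exactly. -/
theorem choose_add_le_exp {m : ℕ} (hm : 0 < m) (a : ℕ) :
    ((2 * m).choose (m + a) : ℝ) ≤ (m.centralBinom : ℝ) *
      Real.exp (-((a : ℝ) * (a - 1) / m + ((a : ℝ) * (a - 1)) ^ 2 / (6 * m ^ 3))) := by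
  have hm' : (0 : ℝ) < m := by exact_mod_cast hm
  induction a with
  | zero => simp [Nat.centralBinom]
  | succ a ih =>
    rcases Nat.lt_or_ge m (a + 1) with h | h
    · rw [Nat.choose_eq_zero_of_lt (by omega)]
      simp only [Nat.cast_zero]; positivity
    have hr : ((2 * m).choose (m + (a + 1)) : ℝ) * (m + a + 1) = (2 * m).choose (m + a) * (m - a) := by
      have := Nat.choose_succ_right_eq (2 * m) (m + a)
      rw [show 2 * m - (m + a) = m - a by omega] at this
      have h2 : ((m - a : ℕ) : ℝ) = m - a := Nat.cast_sub (by omega)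
      rw [← h2]; exact_mod_cast this
    have ham : (a : ℝ) ≤ m := by exact_mod_cast (by omega : a ≤ m)
    have hu := one_sub_le_one_add_mul_exp (u := a / m) (by positivity) (div_le_one_of_le₀ ham hm'.le)
    have hu' : (m : ℝ) - a ≤ (m + a + 1) * Real.exp (-(2 * (a / m) + 2 / 3 * (a / m : ℝ) ^ 3)) := by
      calc (m : ℝ) - a = m * (1 - a / m) := by field_simp
        _ ≤ m * ((1 + a / m) * Real.exp (-(2 * (a / m) + 2 / 3 * (a / m : ℝ) ^ 3))) := by gcongr
        _ = (m + a) * Real.exp (-(2 * (a / m) + 2 / 3 * (a / m : ℝ) ^ 3)) := by field_simp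
        _ ≤ _ := by gcongr ?_ * _; linarith
    refine le_of_mul_le_mul_right ?_ (show (0 : ℝ) < m + a + 1 by positivity)
    rw [hr]
    calc _ ≤ _ := mul_le_mul ih hu' (by linarith) (by positivity)
      _ = _ := by
        rw [mul_comm ((m : ℝ) + a + 1), mul_assoc, mul_assoc, ← mul_assoc (Real.exp _),
          ← Real.exp_add]
        congr 4
        push_cast
        field_simp
        ring

/-- The inverse ratio is `1 + (2 j + 1) / (m - j) ≤ exp ((2 j + 1) / (m - j))`. The odd numbers sum
to `a ^ 2`, and every denominator is at least `m - a`. -/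
theorem exp_le_choose_add {m : ℕ} {a : ℕ} (h : a < m) :
    (m.centralBinom : ℝ) * Real.exp (-((a : ℝ) ^ 2 / (m - a))) ≤ (2 * m).choose (m + a) := by
  induction a with
  | zero => simp [Nat.centralBinom]
  | succ a ih =>
    have ih := ih (by omega)
    have hr : ((2 * m).choose (m + (a + 1)) : ℝ) * (m + a + 1) = (2 * m).choose (m + a) * (m - a) := by
      have := Nat.choose_succ_right_eq (2 * m) (m + a)
      rw [show 2 * m - (m + a) = m - a by omega] at this
      have h2 : ((m - a : ℕ) : ℝ) = m - a := Nat.cast_sub (by omega)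
      rw [← h2]; exact_mod_cast this
    have ham : (a : ℝ) + 1 < m := by exact_mod_cast h
    have h1 : (0 : ℝ) < m - a := by linarith
    have h1' : (0 : ℝ) < m - (a + 1) := by linarith
    have hz : Real.exp (-((2 * a + 1) / (m - a) : ℝ)) * (m + a + 1) ≤ m - a := by
      have := Real.add_one_le_exp ((2 * a + 1) / (m - a) : ℝ)
      rw [Real.exp_neg, inv_mul_le_iff₀ (Real.exp_pos _)]
      calc (m : ℝ) + a + 1 = ((2 * a + 1) / (m - a) + 1) * (m - a) := by field_simp; ring
        _ ≤ _ := by gcongr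
    refine le_of_mul_le_mul_right ?_ (show (0 : ℝ) < m + a + 1 by positivity)
    rw [hr]
    refine le_trans ?_ (mul_le_mul ih hz (by positivity) (by positivity))
    rw [mul_assoc, mul_assoc, ← mul_assoc (Real.exp _) (Real.exp _), ← Real.exp_add]
    gcongr
    rw [← neg_add, neg_le_neg_iff, ← sub_nonneg]
    push_cast
    have : ((a : ℝ) + 1) ^ 2 / (m - (a + 1)) - (a ^ 2 / (m - a) + (2 * a + 1) / (m - a)) =
      ((a : ℝ) + 1) ^ 2 / ((m - (a + 1)) * (m - a)) := by
      field_simp; ring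
    rw [this]; positivity

/-- For `m > 0` the sequence equals `stirlingSeq (2 m) / stirlingSeq m ^ 2`, with limit `√π / π`. -/
theorem tendsto_sqrt_mul_centralBinom :
    Tendsto (fun m : ℕ => √m * (m.centralBinom / 4 ^ m : ℝ)) atTop (𝓝 (1 / √Real.pi)) := by
  have h1 := Stirling.tendsto_stirlingSeq_sqrt_pi
  have h2 := h1.comp (tendsto_id.const_mul_atTop' (show 0 < 2 by norm_num))
  have hpi : √Real.pi ≠ 0 := by positivity
  have h3 := h2.div (h1.pow 2) (by positivity)
  have h4 : √Real.pi / √Real.pi ^ 2 = 1 / √Real.pi := by field_simp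
  rw [h4] at h3
  refine h3.congr' ?_
  filter_upwards [eventually_gt_atTop 0] with m hm
  have hm' : (0 : ℝ) < m := by exact_mod_cast hm
  have hc : (m.centralBinom : ℝ) * ((m.factorial : ℝ)) ^ 2 = ((2 * m).factorial : ℝ) := by
    have := Nat.add_choose_mul_factorial_mul_factorial m m
    rw [← two_mul] at this
    rw [Nat.centralBinom, sq, ← mul_assoc]
    exact_mod_cast this
  have hf : (m.factorial : ℝ) ≠ 0 := by positivity
  have hc' : (m.centralBinom : ℝ) = ((2 * m).factorial : ℝ) / (m.factorial : ℝ) ^ 2 := by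
    field_simp; linarith
  simp only [Function.comp, id, Stirling.stirlingSeq, Pi.div_apply]
  rw [hc']
  have hs : √(2 * ((2 * m : ℕ) : ℝ)) = 2 * √m := by
    rw [Nat.cast_mul, ← mul_assoc, Real.sqrt_mul (by norm_num)]
    norm_num
  have hs2 : √(2 * (m : ℝ)) ^ 2 = 2 * m := Real.sq_sqrt (by positivity)
  have hs3 : √(m : ℝ) ^ 2 = m := Real.sq_sqrt (by positivity)
  have hp : (((2 * m : ℕ) : ℝ) / Real.exp 1) ^ (2 * m) = 4 ^ m * ((m / Real.exp 1) ^ m) ^ 2 := by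
    rw [← pow_mul, mul_comm m 2, Nat.cast_mul, mul_div_assoc, mul_pow, pow_mul ((2 : ℕ) : ℝ)]
    norm_num
  rw [hs, hp, div_pow (m.factorial : ℝ), mul_pow (√_), hs2]
  have : 0 < √(m : ℝ) := by positivity
  field_simp
  rw [hs3]

/-! ### The walk average as an integral of a step density -/

/-- The probability that a simple random walk is at `2 l` after `2 m` steps. -/
noncomputable def walkWeight (m : ℕ) (l : ℤ) : ℝ := ((2 * m).choose (m + l.natAbs) : ℝ) / 4 ^ m

theorem lintegral_comp_floor (g : ℤ → ENNReal) (R : ℝ) {δ : ℝ} (hδ : 0 < δ) :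
    ∫⁻ y : ℝ, g ⌊(y - R) / δ⌋ = ∑' l : ℤ, ENNReal.ofReal δ * g l := by
  have hm : Measurable fun y : ℝ => ⌊(y - R) / δ⌋ :=
    Int.measurable_floor.comp ((measurable_id.sub_const R).div_const δ)
  rw [← lintegral_map (f := g) (measurable_of_countable g) hm, lintegral_countable']
  refine tsum_congr fun l => ?_
  rw [Measure.map_apply hm (measurableSet_singleton l)]
  have : (fun y : ℝ => ⌊(y - R) / δ⌋) ⁻¹' {l} = Set.Ico (R + l * δ) (R + (l + 1) * δ) := by
    ext y
    simp only [Set.mem_preimage, Set.mem_singleton_iff, Int.floor_eq_iff, Set.mem_Ico,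
      le_div_iff₀ hδ, div_lt_iff₀ hδ]
    constructor <;> rintro ⟨h1, h2⟩ <;> constructor <;> linarith
  rw [this, Real.volume_Ico, mul_comm]
  congr 2; ring

theorem ofReal_backwardPotential_even {φ : ℝ → ℝ} (hφ : ∀ x, 0 ≤ φ x) {h : ℝ} (hh : 0 < h)
    (m : ℕ) (R : ℝ) :
    ENNReal.ofReal (backwardPotential h φ (2 * m) R) =
      ∫⁻ y : ℝ, ENNReal.ofReal (walkWeight m ⌊(y - R) / (2 * h)⌋ / (2 * h) *
        φ (R + ⌊(y - R) / (2 * h)⌋ * (2 * h))) := by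
  rw [lintegral_comp_floor (fun l : ℤ => ENNReal.ofReal (walkWeight m l / (2 * h) *
        φ (R + l * (2 * h)))) R (by positivity), tsum_eq_sum (s := Finset.Icc (-(m : ℤ)) m),
        backwardPotential_even, ENNReal.ofReal_sum_of_nonneg]
  · refine Finset.sum_congr rfl fun l _ => ?_
    rw [← ENNReal.ofReal_mul (by positivity)]
    congr 1
    unfold walkWeight
    field_simp
  · intro l _
    exact mul_nonneg (by positivity) (hφ _)
  · intro l hl
    rw [walkWeight, Nat.choose_eq_zero_of_lt]
    · simp
    · rw [Finset.mem_Icc] at hl; omega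

theorem abs_sub_floor_mul_le (x : ℝ) {δ : ℝ} (hδ : 0 < δ) : |⌊x / δ⌋ * δ - x| ≤ δ := by
  have h1 := Int.floor_le (x / δ)
  have h2 := Int.lt_floor_add_one (x / δ)
  rw [le_div_iff₀ hδ] at h1
  rw [div_lt_iff₀ hδ] at h2
  rw [abs_le]; constructor <;> linarith

/-! ### Uniform domination by the limiting Gaussian -/

/-- The Gaussian exponent is dominated, up to a constant, by the exponent of the random walk; the
quartic term absorbs the excess variance caused by a step size of up to `s (1 + s)`. -/
theorem gaussianExponent_le_walkExponent {v s h x : ℝ} {m a : ℕ} (hv : 0 < v) (hs : 0 < s) (hs1 : s ≤ 1)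
    (hsv : 12 * s ^ 2 ≤ v) (hm : |2 * m * s ^ 2 - v| ≤ 3 * s ^ 2) (hsh : s ≤ h)
    (hhs : h ≤ s * (1 + s)) (ham : a ≤ m) (hx : |x| ≤ (a + 1) * (2 * h)) :
    x ^ 2 / (2 * v) ≤ (a : ℝ) * (a - 1) / m + ((a : ℝ) * (a - 1)) ^ 2 / (6 * m ^ 3) +
      (4 * (1 + (3 + 12 / v)) + 2 * (3 + 12 / v) ^ 2 * v) := by
  obtain ⟨hm1, hm2⟩ := abs_le.1 hm
  have hh : 0 < h := hs.trans_le hsh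
  have hm0 : (0 : ℝ) < m := by
    by_contra hcon
    have : (m : ℝ) * s ^ 2 ≤ 0 := mul_nonpos_of_nonpos_of_nonneg (not_lt.1 hcon) (sq_nonneg s)
    nlinarith [sq_nonneg s]
  have hm1' : (1 : ℝ) ≤ m := by
    have : 0 < m := by exact_mod_cast hm0
    exact_mod_cast this
  have ham' : (a : ℝ) ≤ m := by exact_mod_cast ham
  have hA : (0 : ℝ) ≤ (a : ℝ) * (a - 1) := by
    rcases Nat.eq_zero_or_pos a with rfl | ha
    · simp
    · have : (1 : ℝ) ≤ a := by exact_mod_cast ha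
      exact mul_nonneg (by positivity) (by linarith)
  set A : ℝ := (a : ℝ) * (a - 1) with hAdef
  set K : ℝ := 3 + 12 / v with hK
  have hK0 : 0 < K := by positivity
  have hKv : K * v = 3 * v + 12 := by rw [hK]; field_simp
  have hx2 : x ^ 2 ≤ (A + 3 * a + 1) * (4 * h ^ 2) := by
    have : |x| ^ 2 ≤ ((a + 1) * (2 * h)) ^ 2 := by gcongr
    rw [sq_abs] at this
    rw [hAdef]; linarith
  -- `K` comes from `(v + 3 s²)(1 + 3 s) ≤ v + (3 v + 12) s` for `s ≤ 1`.
  have hh2 : 2 * h ^ 2 / v ≤ (1 + K * s) / m := by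
    rw [div_le_div_iff₀ hv hm0]
    have h1 : h ^ 2 ≤ s ^ 2 * (1 + 3 * s) := by
      calc h ^ 2 ≤ (s * (1 + s)) ^ 2 := by gcongr
        _ = s ^ 2 * (1 + 2 * s + s * s) := by ring
        _ ≤ s ^ 2 * (1 + 3 * s) := mul_le_mul_of_nonneg_left (by nlinarith) (sq_nonneg s)
    calc 2 * h ^ 2 * m ≤ 2 * (s ^ 2 * (1 + 3 * s)) * m := by gcongr
      _ = (2 * m * s ^ 2) * (1 + 3 * s) := by ring
      _ ≤ (v + 3 * s ^ 2) * (1 + 3 * s) := by gcongr; linarith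
      _ ≤ v + (K * v) * s := by
        rw [hKv]
        have : s ^ 2 ≤ s := by nlinarith
        have : s ^ 3 ≤ s := by nlinarith
        linarith
      _ = _ := by ring
  have hE : x ^ 2 / (2 * v) ≤ (1 + K * s) / m * (A + 3 * a + 1) := by
    calc x ^ 2 / (2 * v) ≤ (A + 3 * a + 1) * (4 * h ^ 2) / (2 * v) := by gcongr
      _ = 2 * h ^ 2 / v * (A + 3 * a + 1) := by field_simp; ring
      _ ≤ _ := by gcongr
  have h3 : (1 + K * s) / m * (3 * a + 1) ≤ 4 * (1 + K) := by
    rw [div_mul_eq_mul_div, div_le_iff₀ hm0]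
    calc (1 + K * s) * (3 * a + 1) ≤ (1 + K * 1) * (4 * m) := by
          gcongr; linarith
      _ = _ := by ring
  -- The excess `K s A / m` is unbounded over the range of the walk. Completing the square trades it
  -- for the quartic term plus a multiple of `m s²`, which is bounded.
  have h4 : K * s * (A / m) ≤ A ^ 2 / (6 * m ^ 3) + 2 * K ^ 2 * v := by
    have h5 : A ^ 2 / (6 * m ^ 3) + 3 / 2 * K ^ 2 * (m * s ^ 2) - K * s * (A / m) =
        (A / m - 3 * m * K * s) ^ 2 / (6 * m) := by field_simp; ring
    have h6 : 0 ≤ (A / m - 3 * m * K * s) ^ 2 / (6 * m) := by positivity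
    have h7 : 3 / 2 * K ^ 2 * (m * s ^ 2) ≤ 2 * K ^ 2 * v := by
      have : (m : ℝ) * s ^ 2 ≤ v := by linarith
      calc 3 / 2 * K ^ 2 * (m * s ^ 2) ≤ 2 * K ^ 2 * (m * s ^ 2) := by gcongr; norm_num
        _ ≤ _ := by gcongr
    linarith
  have h8 : (1 + K * s) / m * (A + 3 * a + 1) =
    A / m + K * s * (A / m) + (1 + K * s) / m * (3 * a + 1) := by ring
  linarith

/-- The density of the random walk is bounded by a constant multiple of the limiting Gaussian
density, uniformly over the whole range of the walk. -/
theorem exists_walkWeight_le {v : ℝ} (hv : 0 < v) : ∃ C : ℝ, 0 ≤ C ∧ ∀ (s h x : ℝ) (m : ℕ),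
    0 < s → s ≤ 1 → 12 * s ^ 2 ≤ v → |2 * m * s ^ 2 - v| ≤ 3 * s ^ 2 → s ≤ h → h ≤ s * (1 + s) →
    √m * (m.centralBinom / 4 ^ m : ℝ) ≤ 1 →
    walkWeight m ⌊x / (2 * h)⌋ / (2 * h) ≤ C * Real.exp (-x ^ 2 / (2 * v)) := by
  set C₀ : ℝ := 4 * (1 + (3 + 12 / v)) + 2 * (3 + 12 / v) ^ 2 * v with hC₀
  refine ⟨(√v)⁻¹ * Real.exp C₀, by positivity, fun s h x m hs hs1 hsv hm hsh hhs hcb => ?_⟩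
  have hh : 0 < h := hs.trans_le hsh
  set l := ⌊x / (2 * h)⌋ with hl
  rcases Nat.lt_or_ge m l.natAbs with hlm | hlm
  · rw [walkWeight, Nat.choose_eq_zero_of_lt (by omega)]
    simp only [Nat.cast_zero, zero_div]; positivity
  have hm0 : (0 : ℝ) < m := by
    obtain ⟨hm1, hm2⟩ := abs_le.1 hm
    by_contra hcon
    have : (m : ℝ) * s ^ 2 ≤ 0 := mul_nonpos_of_nonpos_of_nonneg (not_lt.1 hcon) (sq_nonneg s)
    nlinarith [sq_nonneg s]
  have hxl : |x| ≤ ((l.natAbs : ℝ) + 1) * (2 * h) := by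
    have h1 := abs_sub_floor_mul_le x (show 0 < 2 * h by positivity)
    rw [abs_sub_comm] at h1
    have h2 := abs_sub_abs_le_abs_sub x (l * (2 * h))
    rw [abs_mul (l : ℝ), abs_of_pos (show 0 < 2 * h by positivity)] at h2
    have h3 : (l.natAbs : ℝ) = |(l : ℝ)| := by rw [Nat.cast_natAbs]; simp
    rw [h3]; linarith
  have hE := gaussianExponent_le_walkExponent hv hs hs1 hsv hm hsh hhs hlm hxl
  have hw := choose_add_le_exp (m := m) (by exact_mod_cast hm0) l.natAbs
  have hpre : (m.centralBinom / 4 ^ m : ℝ) / (2 * h) ≤ (√v)⁻¹ := by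
    have h1 : √v ≤ 2 * h * √m := by
      rw [Real.sqrt_le_iff]
      refine ⟨by positivity, ?_⟩
      rw [mul_pow, Real.sq_sqrt hm0.le]
      obtain ⟨hm1, hm2⟩ := abs_le.1 hm
      have : s ^ 2 * m ≤ h ^ 2 * m := by gcongr
      nlinarith
    have h2 : 0 < √(m : ℝ) := Real.sqrt_pos.2 hm0
    calc (m.centralBinom / 4 ^ m : ℝ) / (2 * h)
        = √m * (m.centralBinom / 4 ^ m : ℝ) / (2 * h * √m) := by field_simp
      _ ≤ 1 / (2 * h * √m) := by gcongr
      _ ≤ 1 / √v := by gcongr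
      _ = _ := one_div _
  calc walkWeight m l / (2 * h)
      ≤ (m.centralBinom : ℝ) * Real.exp (-((l.natAbs : ℝ) * (l.natAbs - 1) / m +
        ((l.natAbs : ℝ) * (l.natAbs - 1)) ^ 2 / (6 * m ^ 3))) / 4 ^ m / (2 * h) := by
        unfold walkWeight; gcongr
    _ = (m.centralBinom / 4 ^ m : ℝ) / (2 * h) * Real.exp (-((l.natAbs : ℝ) * (l.natAbs - 1) / m +
        ((l.natAbs : ℝ) * (l.natAbs - 1)) ^ 2 / (6 * m ^ 3))) := by ring
    _ ≤ (√v)⁻¹ * Real.exp (C₀ + -x ^ 2 / (2 * v)) := by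
        gcongr
        rw [neg_div]; linarith
    _ = _ := by rw [Real.exp_add]; ring

/-! ### Local limit theorem -/

theorem tendsto_atTop_of_tendsto_mul_sq {c : ℝ} (hc : 0 < c) {δ : ℕ → ℝ} {m : ℕ → ℕ}
    (hδ : ∀ k, 0 < δ k) (hδ0 : Tendsto δ atTop (𝓝 0))
    (hm : Tendsto (fun k => (m k : ℝ) * δ k ^ 2) atTop (𝓝 c)) : Tendsto m atTop atTop := by
  have hδ2 : Tendsto (fun k => (δ k ^ 2)⁻¹) atTop atTop := by
    refine Tendsto.inv_tendsto_nhdsGT_zero (tendsto_nhdsWithin_iff.2 ⟨?_, ?_⟩)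
    · simpa using hδ0.pow 2
    · exact Eventually.of_forall fun k => pow_pos (hδ k) 2
  rw [← tendsto_natCast_atTop_iff (R := ℝ)]
  refine (hm.pos_mul_atTop hc hδ2).congr fun k => ?_
  have := (hδ k).ne'
  field_simp

/-- Local limit theorem for the simple random walk. -/
theorem tendsto_walkWeight {v : ℝ} (hv : 0 < v) {δ : ℕ → ℝ} {m : ℕ → ℕ} (hδ : ∀ k, 0 < δ k)
    (hδ0 : Tendsto δ atTop (𝓝 0)) (hm : Tendsto (fun k => (m k : ℝ) * δ k ^ 2) atTop (𝓝 (2 * v)))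
    (x : ℝ) :
    Tendsto (fun k => walkWeight (m k) ⌊x / δ k⌋ / δ k) atTop
      (𝓝 ((√(2 * Real.pi * v))⁻¹ * Real.exp (-x ^ 2 / (2 * v)))) := by
  have hmtop : Tendsto m atTop atTop :=
    tendsto_atTop_of_tendsto_mul_sq (by positivity) hδ hδ0 hm
  have hm0 : ∀ᶠ k in atTop, 0 < m k := hmtop.eventually_gt_atTop 0
  set a : ℕ → ℕ := fun k => ⌊x / δ k⌋.natAbs with ha
  have hl : Tendsto (fun k => (⌊x / δ k⌋ : ℝ) * δ k) atTop (𝓝 x) := by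
    rw [tendsto_iff_norm_sub_tendsto_zero]
    exact squeeze_zero (fun _ => norm_nonneg _) (fun k => abs_sub_floor_mul_le x (hδ k)) hδ0
  have haδ : Tendsto (fun k => (a k : ℝ) * δ k) atTop (𝓝 |x|) := by
    refine hl.abs.congr fun k => ?_
    rw [abs_mul, abs_of_pos (hδ k), ha, Nat.cast_natAbs]; simp
  have h2v : 2 * v ≠ 0 := by positivity
  have ham : Tendsto (fun k => (a k : ℝ) / m k) atTop (𝓝 0) := by
    have := (haδ.mul hδ0).div hm h2v
    simp only [mul_zero, zero_div] at this
    refine this.congr fun k => ?_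
    have := (hδ k).ne'
    simp only [Pi.div_apply]
    field_simp
  have ha2m : Tendsto (fun k => (a k : ℝ) ^ 2 / m k) atTop (𝓝 (x ^ 2 / (2 * v))) := by
    have := (haδ.pow 2).div hm h2v
    rw [sq_abs] at this
    refine this.congr fun k => ?_
    have := (hδ k).ne'
    simp only [Pi.div_apply]
    field_simp
  have hlt : ∀ᶠ k in atTop, a k < m k := by
    filter_upwards [ham.eventually_lt_const one_pos, hm0] with k hk hk0
    rw [div_lt_one (by exact_mod_cast hk0)] at hk
    exact_mod_cast hk
  have hP : Tendsto (fun k => ((m k).centralBinom / 4 ^ (m k) : ℝ) / δ k) atTop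
      (𝓝 ((√(2 * Real.pi * v))⁻¹)) := by
    have hs := (tendsto_sqrt_mul_centralBinom.comp hmtop).div hm.sqrt (by positivity)
    have : 1 / √Real.pi / √(2 * v) = (√(2 * Real.pi * v))⁻¹ := by
      rw [div_div, ← Real.sqrt_mul (by positivity), one_div]; congr 2; ring
    rw [this] at hs
    refine hs.congr' ?_
    filter_upwards [hm0] with k hk
    have h1 : 0 < √(m k : ℝ) := Real.sqrt_pos.2 (by exact_mod_cast hk)
    have := (hδ k).ne'
    simp only [Function.comp, Pi.div_apply]
    rw [Real.sqrt_mul (by positivity), Real.sqrt_sq (hδ k).le]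
    field_simp
  -- Since `a / m → 0`, the exponents `a² / (m - a)` and `a² / m - a / m` of the two binomial bounds
  -- share the limit `x² / (2 v)`. The quartic term is not needed here.
  have hlow : Tendsto (fun k => ((m k).centralBinom / 4 ^ (m k) : ℝ) / δ k *
      Real.exp (-((a k : ℝ) ^ 2 / (m k - a k)))) atTop
      (𝓝 ((√(2 * Real.pi * v))⁻¹ * Real.exp (-x ^ 2 / (2 * v)))) := by
    refine hP.mul ((Real.continuous_exp.tendsto _).comp ?_)
    have := (ha2m.div (ham.const_sub 1) (by norm_num)).neg
    rw [sub_zero, div_one, ← neg_div] at this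
    refine this.congr' ?_
    filter_upwards [hlt, hm0] with k hk hk0
    have h1 : (0 : ℝ) < m k := by exact_mod_cast hk0
    have h2 : (0 : ℝ) < m k - a k := sub_pos.2 (by exact_mod_cast hk)
    simp only [Pi.div_apply]
    rw [one_sub_div h1.ne', div_div_div_cancel_right₀ h1.ne']
  have hup : Tendsto (fun k => ((m k).centralBinom / 4 ^ (m k) : ℝ) / δ k *
      Real.exp (-((a k : ℝ) ^ 2 / m k - a k / m k))) atTop
      (𝓝 ((√(2 * Real.pi * v))⁻¹ * Real.exp (-x ^ 2 / (2 * v)))) := by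
    refine hP.mul ((Real.continuous_exp.tendsto _).comp ?_)
    have := (ha2m.sub ham).neg
    rwa [sub_zero, ← neg_div] at this
  refine tendsto_of_tendsto_of_tendsto_of_le_of_le' hlow hup ?_ ?_
  · filter_upwards [hlt] with k hk
    have h1 := exp_le_choose_add hk
    have h2 := hδ k
    rw [div_div, div_mul_eq_mul_div, walkWeight, div_div]
    gcongr
  · filter_upwards [hm0] with k hk
    have h1 := choose_add_le_exp hk (a k)
    have h2 := hδ k
    rw [div_div, div_mul_eq_mul_div, walkWeight, div_div]
    gcongr
    refine h1.trans ?_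
    gcongr
    have h3 : (0 : ℝ) ≤ ((a k : ℝ) * (a k - 1)) ^ 2 / (6 * m k ^ 3) := by positivity
    have h4 : (a k : ℝ) * (a k - 1) / m k = (a k : ℝ) ^ 2 / m k - a k / m k := by ring
    linarith

/-! ### Monotonicity in the number of steps and limits in `(0, ∞]` -/

theorem backwardPotential_nonneg {φ : ℝ → ℝ} (hφ : ∀ x, 0 ≤ φ x) (h : ℝ) (n : ℕ) (R : ℝ) :
    0 ≤ backwardPotential h φ n R := by
  induction n generalizing R with
  | zero => exact hφ R
  | succ n ih =>
    rw [backwardPotential]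
    linarith [ih (R + h), ih (R - h)]

/-- Midpoint convexity gives the first step; the recursion is a positive average, so it preserves
the inequality. -/
theorem backwardPotential_monotone {φ : ℝ → ℝ} (hφ : ConvexOn ℝ Set.univ φ) (h R : ℝ) :
    Monotone fun n => backwardPotential h φ n R := by
  refine monotone_nat_of_le_succ fun n => ?_
  induction n generalizing R with
  | zero =>
    have : φ ((1 / 2 : ℝ) • (R + h) + (1 / 2 : ℝ) • (R - h)) ≤ _ :=
      hφ.2 (Set.mem_univ _) (Set.mem_univ _) (by norm_num) (by norm_num) (by norm_num)
    simp only [smul_eq_mul] at this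
    rw [show 1 / 2 * (R + h) + 1 / 2 * (R - h) = R by ring] at this
    simp only [backwardPotential]
    linarith
  | succ n ih =>
    have h1 := ih (R + h)
    have h2 := ih (R - h)
    rw [backwardPotential, backwardPotential]
    linarith

theorem TendstoExpectation.squeeze {u w z : ℕ → ℝ} {f : ℝ → ℝ} {γ : Measure ℝ}
    (hu : TendstoExpectation u f γ) (hz : TendstoExpectation z f γ) (huw : ∀ k, u k ≤ w k)
    (hwz : ∀ k, w k ≤ z k) : TendstoExpectation w f γ :=
  ⟨fun hi => tendsto_of_tendsto_of_tendsto_of_le_of_le (hu.1 hi) (hz.1 hi) huw hwz,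
    fun hi => tendsto_atTop_mono huw (hu.2 hi)⟩

/-- The weights need not converge: the combination lies between the minimum and the maximum. -/
theorem TendstoExpectation.convexCombination {u w c : ℕ → ℝ} {f : ℝ → ℝ} {γ : Measure ℝ}
    (hu : TendstoExpectation u f γ) (hw : TendstoExpectation w f γ) (h0 : ∀ k, 0 ≤ c k)
    (h1 : ∀ k, c k ≤ 1) : TendstoExpectation (fun k => (1 - c k) * u k + c k * w k) f γ := by
  have hmin : TendstoExpectation (fun k => min (u k) (w k)) f γ := by
    refine ⟨fun hi => by simpa using (hu.1 hi).min (hw.1 hi), fun hi => ?_⟩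
    rw [tendsto_atTop]
    intro b
    filter_upwards [tendsto_atTop.1 (hu.2 hi) b, tendsto_atTop.1 (hw.2 hi) b] with k h2 h3
    exact le_min h2 h3
  have hmax : TendstoExpectation (fun k => max (u k) (w k)) f γ :=
    ⟨fun hi => by simpa using (hu.1 hi).max (hw.1 hi),
      fun hi => tendsto_atTop_mono (fun _ => le_max_left _ _) (hu.2 hi)⟩
  refine hmin.squeeze hmax (fun k => ?_) (fun k => ?_)
  · nlinarith [mul_le_mul_of_nonneg_left (min_le_left (u k) (w k)) (sub_nonneg.2 (h1 k)),
      mul_le_mul_of_nonneg_left (min_le_right (u k) (w k)) (h0 k)]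
  · nlinarith [mul_le_mul_of_nonneg_left (le_max_left (u k) (w k)) (sub_nonneg.2 (h1 k)),
      mul_le_mul_of_nonneg_left (le_max_right (u k) (w k)) (h0 k)]

theorem tendstoExpectation_of_tendsto_ofReal {u : ℕ → ℝ} {f : ℝ → ℝ} {γ : Measure ℝ}
    (hu : ∀ k, 0 ≤ u k) (hf : ∀ x, 0 ≤ f x) (hfm : AEStronglyMeasurable f γ)
    (h : Tendsto (fun k => ENNReal.ofReal (u k)) atTop (𝓝 (∫⁻ x, ENNReal.ofReal (f x) ∂γ))) :
    TendstoExpectation u f γ := by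
  have hint : Integrable f γ ↔ ∫⁻ x, ENNReal.ofReal (f x) ∂γ ≠ ⊤ := by
    rw [← lt_top_iff_ne_top, ← hasFiniteIntegral_iff_ofReal (Eventually.of_forall hf)]
    exact ⟨fun hi => hi.2, fun hi => ⟨hfm, hi⟩⟩
  refine ⟨fun hi => ?_, fun hi => ?_⟩
  · rw [integral_eq_lintegral_of_nonneg_ae (Eventually.of_forall hf) hfm]
    refine ((ENNReal.tendsto_toReal (hint.1 hi)).comp h).congr fun k => ?_
    exact ENNReal.toReal_ofReal (hu k)
  · rw [hint, not_not] at hi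
    rw [hi] at h
    rw [tendsto_atTop]
    intro b
    filter_upwards [h.eventually (lt_mem_nhds (ENNReal.ofReal_lt_top (r := b)))] with k hk
    exact (ENNReal.ofReal_lt_ofReal_iff'.1 hk).1.le

/-! ### Convergence of the random walk averages -/

theorem tendstoExpectation_backwardPotential_even {φ : ℝ → ℝ} (hpos : ∀ x, 0 ≤ φ x)
    (hmono : Monotone φ) (hcont : Continuous φ) {v : NNReal} (hv : v ≠ 0) {s h : ℕ → ℝ}
    {m : ℕ → ℕ} (hs : ∀ k, 0 < s k) (hs0 : Tendsto s atTop (𝓝 0))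
    (hm : ∀ k, |2 * m k * s k ^ 2 - v| ≤ 3 * s k ^ 2) (hsh : ∀ k, s k ≤ h k)
    (hhs : ∀ k, h k ≤ s k * (1 + s k)) (R : ℝ) :
    TendstoExpectation (fun k => backwardPotential (h k) φ (2 * m k) R) φ (gaussianReal R v) := by
  have hv' : (0 : ℝ) < v := by positivity
  have hh : ∀ k, 0 < h k := fun k => (hs k).trans_le (hsh k)
  have hratio : Tendsto (fun k => h k / s k) atTop (𝓝 1) := by
    refine tendsto_of_tendsto_of_tendsto_of_le_of_le tendsto_const_nhds
      (by simpa using hs0.const_add 1) (fun k => ?_) (fun k => ?_)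
    · rw [le_div_iff₀ (hs k), one_mul]; exact hsh k
    · rw [div_le_iff₀ (hs k), mul_comm]; exact hhs k
  have hh0 : Tendsto h atTop (𝓝 0) := by
    have := hratio.mul hs0
    rw [mul_zero] at this
    exact this.congr fun k => div_mul_cancel₀ _ (hs k).ne'
  have hms : Tendsto (fun k => 2 * m k * s k ^ 2) atTop (𝓝 (v : ℝ)) := by
    rw [tendsto_iff_norm_sub_tendsto_zero]
    exact squeeze_zero (fun _ => norm_nonneg _) hm (by simpa using (hs0.pow 2).const_mul 3)
  -- The lattice spacing is `2 h`, so the variance `2 m h²` is half of `m (2 h)²`.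
  have hmδ : Tendsto (fun k => (m k : ℝ) * (2 * h k) ^ 2) atTop (𝓝 (2 * (v : ℝ))) := by
    have := (hms.mul (hratio.pow 2)).const_mul 2
    rw [one_pow, mul_one] at this
    refine this.congr fun k => ?_
    have := (hs k).ne'
    field_simp
  have hδ0 : Tendsto (fun k => 2 * h k) atTop (𝓝 0) := by simpa using hh0.const_mul 2
  have hδ : ∀ k, 0 < 2 * h k := fun k => mul_pos two_pos (hh k)
  have hmtop : Tendsto m atTop atTop :=
    tendsto_atTop_of_tendsto_mul_sq (by positivity) hδ hδ0 hmδ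
  set F : ℕ → ℝ → ENNReal := fun k y => ENNReal.ofReal
    (walkWeight (m k) ⌊(y - R) / (2 * h k)⌋ / (2 * h k) *
      φ (R + ⌊(y - R) / (2 * h k)⌋ * (2 * h k))) with hF
  have hFm : ∀ k, Measurable (F k) := fun k =>
    (measurable_of_countable fun l : ℤ => ENNReal.ofReal
      (walkWeight (m k) l / (2 * h k) * φ (R + l * (2 * h k)))).comp
      (Int.measurable_floor.comp ((measurable_id.sub_const R).div_const _))
  have hFu : ∀ k, ENNReal.ofReal (backwardPotential (h k) φ (2 * m k) R) = ∫⁻ y, F k y :=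
    fun k => ofReal_backwardPotential_even hpos (hh k) (m k) R
  have hL : ∫⁻ y, ENNReal.ofReal (φ y) ∂(gaussianReal R v) =
      ∫⁻ y, gaussianPDF R v y * ENNReal.ofReal (φ y) := by
    rw [gaussianReal_of_var_ne_zero _ hv, lintegral_withDensity_eq_lintegral_mul _
      (measurable_gaussianPDF R v) hcont.measurable.ennreal_ofReal]
    rfl
  have hlim : ∀ y, Tendsto (fun k => F k y) atTop
      (𝓝 (gaussianPDF R v y * ENNReal.ofReal (φ y))) := by
    intro y
    rw [gaussianPDF, ← ENNReal.ofReal_mul (gaussianPDFReal_nonneg _ _ _)]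
    refine ENNReal.tendsto_ofReal (Tendsto.mul ?_ ?_)
    · exact tendsto_walkWeight hv' hδ hδ0 hmδ (y - R)
    · refine (hcont.tendsto y).comp ?_
      rw [tendsto_iff_norm_sub_tendsto_zero]
      refine squeeze_zero (fun _ => norm_nonneg _) (fun k => ?_) hδ0
      have := abs_sub_floor_mul_le (y - R) (hδ k)
      rw [Real.norm_eq_abs]
      convert this using 2
      ring
  refine tendstoExpectation_of_tendsto_ofReal (fun k => backwardPotential_nonneg hpos _ _ _) hpos
    hcont.aestronglyMeasurable ?_
  simp only [hFu, hL]
  -- An infinite mean needs no domination: Fatou's lemma already forces the integrals to infinity.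
  by_cases htop : ∫⁻ y, gaussianPDF R v y * ENNReal.ofReal (φ y) = ⊤
  · have := lintegral_liminf_le (μ := volume) (u := atTop) hFm
    simp only [fun y => (hlim y).liminf_eq, htop] at this
    rw [htop]
    exact tendsto_of_le_liminf_of_limsup_le this le_top
  obtain ⟨C, hC0, hC⟩ := exists_walkWeight_le hv'
  set D : ℝ := C * √(2 * Real.pi * v) with hD
  have hev : ∀ᶠ k in atTop, s k ≤ 1 ∧ 12 * s k ^ 2 ≤ v ∧
      √(m k) * ((m k).centralBinom / 4 ^ (m k) : ℝ) ≤ 1 := by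
    have hpi : 1 / √Real.pi < 1 := by
      rw [div_lt_one (by positivity), Real.lt_sqrt zero_le_one]
      linarith [Real.pi_gt_three]
    have h12 : Tendsto (fun k => 12 * s k ^ 2) atTop (𝓝 0) := by
      simpa using (hs0.pow 2).const_mul 12
    filter_upwards [hs0.eventually_le_const one_pos, h12.eventually_le_const hv',
      (tendsto_sqrt_mul_centralBinom.comp hmtop).eventually_le_const hpi] with k h1 h2 h3
    exact ⟨h1, h2, h3⟩
  refine tendsto_lintegral_filter_of_dominated_convergence
    (fun y => ENNReal.ofReal D * (gaussianPDF R v y * ENNReal.ofReal (φ y)))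
    (Eventually.of_forall hFm) ?_ ?_ (Eventually.of_forall hlim)
  · filter_upwards [hev] with k hk
    refine Eventually.of_forall fun y => ?_
    rw [gaussianPDF, ← ENNReal.ofReal_mul (gaussianPDFReal_nonneg _ _ _),
      ← ENNReal.ofReal_mul (by positivity), ← mul_assoc]
    -- `φ` is evaluated at the left end of the cell containing `y`, hence is at most `φ y`.
    refine ENNReal.ofReal_le_ofReal (mul_le_mul ?_ (hmono ?_) (hpos _) ?_)
    · have := hC (s k) (h k) (y - R) (m k) (hs k) hk.1 hk.2.1 (hm k) (hsh k) (hhs k) hk.2.2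
      refine this.trans_eq ?_
      rw [hD, gaussianPDFReal]
      have : √(2 * Real.pi * v) ≠ 0 := by positivity
      field_simp
    · have := Int.floor_le ((y - R) / (2 * h k))
      rw [le_div_iff₀ (hδ k)] at this
      linarith
    · exact mul_nonneg (by positivity) (gaussianPDFReal_nonneg _ _ _)
  · rw [lintegral_const_mul' _ _ ENNReal.ofReal_ne_top]
    exact ENNReal.mul_ne_top ENNReal.ofReal_ne_top htop

theorem tendstoExpectation_backwardPotential {φ : ℝ → ℝ} (hpos : ∀ x, 0 ≤ φ x)
    (hmono : Monotone φ) (hcont : Continuous φ) (hconv : ConvexOn ℝ Set.univ φ) {v : NNReal}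
    {s h : ℕ → ℝ} {n : ℕ → ℕ} (hs : ∀ k, 0 < s k) (hs0 : Tendsto s atTop (𝓝 0))
    (hn : ∀ k, |n k * s k ^ 2 - v| ≤ s k ^ 2) (hsh : ∀ k, s k ≤ h k)
    (hhs : ∀ k, h k ≤ s k * (1 + s k)) (R : ℝ) :
    TendstoExpectation (fun k => backwardPotential (h k) φ (n k) R) φ (gaussianReal R v) := by
  rcases eq_or_ne v 0 with rfl | hv
  · rw [gaussianReal_zero_var]
    refine ⟨fun _ => ?_, fun hi => absurd (integrable_dirac (by simp)) hi⟩
    rw [integral_dirac]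
    have hh0 : Tendsto (fun k => φ (R + s k * (1 + s k))) atTop (𝓝 (φ R)) := by
      refine (hcont.tendsto R).comp ?_
      simpa using (hs0.mul (hs0.const_add 1)).const_add R
    refine tendsto_of_tendsto_of_tendsto_of_le_of_le tendsto_const_nhds hh0
      (fun k => backwardPotential_monotone hconv (h k) R (Nat.zero_le _)) fun k => ?_
    -- At zero variance the tolerance `s²` leaves at most one step.
    have hn1 : n k ≤ 1 := by
      have h1 := (abs_le.1 (hn k)).2
      rw [NNReal.coe_zero, sub_zero] at h1
      have : (n k : ℝ) ≤ 1 := le_of_mul_le_mul_right (by linarith) (pow_pos (hs k) 2)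
      exact_mod_cast this
    have h0 := (hs k).trans_le (hsh k)
    refine (backwardPotential_monotone hconv (h k) R hn1).trans ?_
    have h1 : φ (R + h k) ≤ φ (R + s k * (1 + s k)) := hmono (by linarith [hhs k])
    have h2 : φ (R - h k) ≤ φ (R + s k * (1 + s k)) := hmono (by linarith [hhs k])
    simp only [backwardPotential]
    linarith
  -- Moving `n` to an even number at distance at most `2` costs `2 s²`, which explains the tolerance
  -- `3 s²` in the even case.
  · have key : ∀ m : ℕ → ℕ, (∀ k, |(2 * m k : ℝ) - n k| ≤ 2) →
        TendstoExpectation (fun k => backwardPotential (h k) φ (2 * m k) R) φ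
          (gaussianReal R v) := by
      intro m hm
      refine tendstoExpectation_backwardPotential_even hpos hmono hcont hv hs hs0 (fun k => ?_)
        hsh hhs R
      calc |2 * m k * s k ^ 2 - (v : ℝ)|
          = |(2 * m k - n k) * s k ^ 2 + (n k * s k ^ 2 - v)| := by congr 1; ring
        _ ≤ |(2 * m k : ℝ) - n k| * s k ^ 2 + |n k * s k ^ 2 - v| := by
            refine (abs_add_le _ _).trans_eq ?_
            rw [abs_mul, abs_of_nonneg (sq_nonneg (s k))]
        _ ≤ 2 * s k ^ 2 + s k ^ 2 := by gcongr; exacts [hm k, hn k]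
        _ = _ := by ring
    refine (key (fun k => n k / 2) fun k => ?_).squeeze (key (fun k => n k / 2 + 1) fun k => ?_)
      (fun k => backwardPotential_monotone hconv (h k) R (by omega))
      (fun k => backwardPotential_monotone hconv (h k) R (by omega))
    · have h1 : ((2 * (n k / 2) : ℕ) : ℝ) ≤ n k := by exact_mod_cast (by omega)
      have h2 : (n k : ℝ) ≤ ((2 * (n k / 2) + 1 : ℕ) : ℝ) := by exact_mod_cast (by omega)
      push_cast at h1 h2 ⊢
      rw [abs_le]; constructor <;> linarith
    · have h1 : ((2 * (n k / 2) : ℕ) : ℝ) ≤ n k := by exact_mod_cast (by omega)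
      have h2 : (n k : ℝ) ≤ ((2 * (n k / 2) + 1 : ℕ) : ℝ) := by exact_mod_cast (by omega)
      push_cast at h1 h2 ⊢
      rw [abs_le]; constructor <;> linarith

/-! ### Application to the discrete games -/

theorem StrictlyPositive.continuous {φ : ℝ → ℝ} (hφ : StrictlyPositive 2 φ) : Continuous φ := by
  simpa using (hφ.1 0 (by norm_num)).continuous

theorem StrictlyPositive.monotone {φ : ℝ → ℝ} (hφ : StrictlyPositive 2 φ) : Monotone φ := by
  refine (strictMono_of_deriv_pos fun x => ?_).monotone
  simpa using hφ.2 1 (by norm_num) x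

theorem StrictlyPositive.convexOn {φ : ℝ → ℝ} (hφ : StrictlyPositive 2 φ) :
    ConvexOn ℝ Set.univ φ := by
  refine convexOn_univ_of_deriv2_nonneg ?_ ?_ fun x => ?_
  · simpa using hφ.1 0 (by norm_num)
  · simpa using hφ.1 1 (by norm_num)
  · rw [← iteratedDeriv_eq_iterate]
    exact (hφ.2 2 le_rfl x).le

theorem stepSize_pos {T : ℝ} (hT : 0 < T) (k : ℕ) : 0 < stepSize T k := by
  unfold stepSize; positivity

theorem stepSize_sq {T : ℝ} (hT : 0 < T) (k : ℕ) : 2 ^ (2 * k) * stepSize T k ^ 2 = T := by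
  rw [stepSize, div_pow, Real.sq_sqrt hT.le, ← pow_mul, mul_comm k 2]
  field_simp

theorem tendsto_stepSize (T : ℝ) : Tendsto (stepSize T) atTop (𝓝 0) :=
  tendsto_const_nhds.div_atTop (tendsto_pow_atTop_atTop_of_one_lt one_lt_two)

/-- Allowing any `h` between `s` and `s (1 + s)` treats both strategies at once. Since `2 ^ (2 k) s²
= T`, the time left differs from `T - t` exactly as the grid time differs from `t`. -/
theorem tendstoExpectation_gridPotential {T : ℝ} {φ : ℝ → ℝ} (hφ : StrictlyPositive 2 φ)
    {t : ℝ} (ht : 0 < t) (htT : t ≤ T) {h : ℕ → ℝ} (hsh : ∀ k, stepSize T k ≤ h k)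
    (hhs : ∀ k, h k ≤ stepSize T k * (1 + stepSize T k)) {i : ℕ → ℕ} (hi : ∀ k, i k ≤ 2 ^ (2 * k))
    (hit : ∀ k, |(i k : ℝ) * stepSize T k ^ 2 - t| ≤ stepSize T k ^ 2) (R : ℝ) :
    TendstoExpectation (fun k => backwardPotential (h k) φ (2 ^ (2 * k) - i k) R) φ
      (gaussianReal R (T - t).toNNReal) := by
  have hT := ht.trans_le htT
  refine tendstoExpectation_backwardPotential (fun x => by simpa using (hφ.2 0 (by norm_num) x).le)
    hφ.monotone hφ.continuous hφ.convexOn (stepSize_pos hT) (tendsto_stepSize T) (fun k => ?_)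
    hsh hhs R
  rw [Real.coe_toNNReal _ (sub_nonneg.2 htT), Nat.cast_sub (hi k), abs_sub_comm]
  push_cast
  convert hit k using 2
  linear_combination -stepSize_sq hT k

theorem tendstoExpectation_timeInterpolation {T : ℝ} {φ : ℝ → ℝ} (hφ : StrictlyPositive 2 φ)
    {t : ℝ} (ht : 0 < t) (htT : t ≤ T) {h : ℕ → ℝ} (hsh : ∀ k, stepSize T k ≤ h k)
    (hhs : ∀ k, h k ≤ stepSize T k * (1 + stepSize T k)) (R : ℝ) :
    TendstoExpectation (fun k => timeInterpolation (stepSize T k ^ 2)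
      (fun i => backwardPotential (h k) φ (2 ^ (2 * k) - i) R) t) φ
      (gaussianReal R (T - t).toNNReal) := by
  have hT := ht.trans_le htT
  have hδ : ∀ k, 0 < stepSize T k ^ 2 := fun k => pow_pos (stepSize_pos hT k) 2
  have hle : ∀ k, (⌊t / stepSize T k ^ 2⌋₊ : ℝ) * stepSize T k ^ 2 ≤ t := fun k =>
    (le_div_iff₀ (hδ k)).1 (Nat.floor_le (div_nonneg ht.le (hδ k).le))
  have hlt : ∀ k, t < (⌊t / stepSize T k ^ 2⌋₊ + 1 : ℝ) * stepSize T k ^ 2 := fun k =>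
    (div_lt_iff₀ (hδ k)).1 (Nat.lt_floor_add_one _)
  have hfl : ∀ k, ⌊t / stepSize T k ^ 2⌋₊ ≤ 2 ^ (2 * k) := by
    intro k
    have h1 : (⌊t / stepSize T k ^ 2⌋₊ : ℝ) ≤ 2 ^ (2 * k) :=
      le_of_mul_le_mul_right (((hle k).trans htT).trans_eq (stepSize_sq hT k).symm) (hδ k)
    exact_mod_cast h1
  have h0 := tendstoExpectation_gridPotential hφ ht htT hsh hhs
    (i := fun k => ⌊t / stepSize T k ^ 2⌋₊) hfl (fun k => by
      rw [abs_le]; constructor <;> linarith [hle k, hlt k, hδ k]) R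
  -- At `t = T` the right neighbour lies beyond the last grid time. Capping the index changes
  -- nothing, because truncated subtraction gives zero remaining steps in both cases.
  have h1 := tendstoExpectation_gridPotential hφ ht htT hsh hhs
    (i := fun k => min (⌊t / stepSize T k ^ 2⌋₊ + 1) (2 ^ (2 * k))) (fun k => min_le_right _ _)
    (fun k => by
      have h2 := stepSize_sq hT k
      have h3 := hle k
      have h4 := hlt k
      rcases le_total (⌊t / stepSize T k ^ 2⌋₊ + 1) (2 ^ (2 * k)) with h | h
      · rw [min_eq_left h, abs_le]
        push_cast
        constructor <;> linarith [hδ k]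
      · rw [min_eq_right h, abs_le]
        have h5 : ((2 : ℝ) ^ (2 * k)) * stepSize T k ^ 2 ≤
            (⌊t / stepSize T k ^ 2⌋₊ + 1 : ℝ) * stepSize T k ^ 2 := by
          gcongr
          exact_mod_cast h
        push_cast
        constructor <;> linarith [hδ k]) R
  refine Eq.mp (congrArg (TendstoExpectation · _ _) (funext fun k => ?_))
    (h0.convexCombination h1 (fun k => Int.fract_nonneg (t / stepSize T k ^ 2))
    fun k => (Int.fract_lt_one _).le)
  have h2 : 2 ^ (2 * k) - min (⌊t / stepSize T k ^ 2⌋₊ + 1) (2 ^ (2 * k)) =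
    2 ^ (2 * k) - (⌊t / stepSize T k ^ 2⌋₊ + 1) := by omega
  simp only [timeInterpolation, h2]

theorem mainTheorem2 (T : ℝ) (φ : ℝ → ℝ) (hφ : StrictlyPositive 2 φ)
    (t : ℝ) (ht : 0 < t) (htT : t ≤ T) (R₀ : ℝ) :
    (TendstoExpectation (fun k => upperPotential T φ k t R₀) φ
        (gaussianReal R₀ (T - t).toNNReal) ∧
      TendstoExpectation (fun k => lowerPotential T φ k t R₀) φ
        (gaussianReal R₀ (T - t).toNNReal)) ∧
    ∀ i : ℕ → ℕ, (∀ k, i k ≤ 2 ^ (2 * k)) →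
      (∀ k, |(i k : ℝ) * stepSize T k ^ 2 - t| ≤ stepSize T k ^ 2) →
      TendstoExpectation (fun k => upperGridPotential T φ k (i k) R₀) φ
          (gaussianReal R₀ (T - t).toNNReal) ∧
        TendstoExpectation (fun k => lowerGridPotential T φ k (i k) R₀) φ
          (gaussianReal R₀ (T - t).toNNReal) := by
  have hs := fun k => (stepSize_pos (ht.trans_le htT) k).le
  have hl : ∀ k, stepSize T k ≤ stepSize T k * (1 + stepSize T k) := fun k =>
    le_mul_of_one_le_right (hs k) (by linarith [hs k])
  exact ⟨⟨tendstoExpectation_timeInterpolation hφ ht htT hl (fun _ => le_rfl) R₀,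
    tendstoExpectation_timeInterpolation hφ ht htT (fun _ => le_rfl) hl R₀⟩,
    fun i hi hit => ⟨tendstoExpectation_gridPotential hφ ht htT hl (fun _ => le_rfl) hi hit R₀,
      tendstoExpectation_gridPotential hφ ht htT (fun _ => le_rfl) hl hi hit R₀⟩⟩
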